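/- Let $(\mathsf Z,\mathcal Z)$ be a measurable space with a probability measure $\mathbb P_\xi$, let $f:\mathbb R^d\to\mathbb R$, and let $\nabla F:\mathbb R^d\times\mathsf Z\to\mathbb R^d$ be a jointly measurable stochastic gradient. Here $\|\cdot\|$ is the Euclidean norm, and the associated operator norm on derivatives. Assume: 1. (Strong convexity) $f$ is continuously differentiable and there is $\mu>0$ with $\frac{\mu}{2}\|\theta-\theta'\|^2\le f(\theta)-f(\theta')-\langle\nabla f(\theta'),\theta-\theta'\rangle$ for all $\theta,\theta'\in\mathbb R^d$. Let $\theta^\star$ be the minimizer of $f$. 2. (Smoothness) $f$ is four times continuously differentiable and there are $L_2,L_3,L_4\ge 0$ such that $\|\nabla f(\theta)-\nabla f(\theta')\|\le L_2\|\theta-\theta'\|$, $\|\nabla^3 f(\theta)\|\le L_3$ and $\|\nabla^4 f(\theta)\|\le L_4$ for all $\theta,\theta'\in\mathbb R^d$. 3. (Noise, A(2)) For all $\theta\in\mathbb R^d$, $\mathsf E_{\xi\sim\mathbb P_\xi}[\nabla F(\theta,\xi)]=\nabla f(\theta)$; there is $\tau_2\ge 0$ with $\mathsf E^{1/2}_{\xi\sim\mathbb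 P_\xi}[\|\nabla F(\theta^\star,\xi)\|^2]\le\tau_2$; and there is $L_1>0$ with $\mathsf E_{\xi\sim\mathbb P_\xi}[\|\nabla F(\theta_1,\xi)-\nabla F(\theta_2,\xi)\|^2]\le L_1\langle\nabla f(\theta_1)-\nabla f(\theta_2),\theta_1-\theta_2\rangle$ for all $\theta_1,\theta_2\in\mathbb R^d$. Put $L=\max(L_1,L_2,L_3,L_4)$. For $\gamma\in(0,1/(2L)]$ consider the Markov kernel of constant-step SGD, $$Q_\gamma(\theta,A)=\int_{\mathsf Z}\mathbf 1_A\bigl(\theta-\gamma\nabla F(\theta,z)\bigr)\,\mathbb P_\xi(dz),\qquad \theta\in\mathbb R^d,\ A\subseteq\mathbb R^d\text{ Borel},$$ the cost function $$c(\theta,\theta')=\|\theta-\theta'\|\Bigl(\|\theta-\theta^\star\|+\|\theta'-\theta^\star\|+\frac{2\sqrt2\,\tau_2\sqrt\gamma}{\sqrt\mu}\Bigr),$$ and, for probability measures $\nu,\nu'$ on $\mathbb R^d$, $W_c(\nu,\nu')=\inf_{\mathcal C}\int c(\theta,\theta')\,\mathcal C(d\theta,d\theta')\in[0,\infty]$,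 the infimum being over all couplings $\mathcal C$ of $\nu$ and $\nu'$. Then for every $\gamma\in(0,1/(2L)]$ the kernel $Q_\gamma$ has a unique invariant probability distribution $\pi_\gamma$, and for every probability measure $\nu$ on $\mathbb R^d$ and every $k\in\mathbb N$, $$W_c(\nu Q_\gamma^k,\pi_\gamma)\le 4\,(1/2)^{k/m(\gamma)}\,W_c(\nu,\pi_\gamma),\qquad m(\gamma)=\Bigl\lceil\frac{2\log 4}{\gamma\mu}\Bigr\rceil.$$ -/

import Mathlib

open MeasureTheory ProbabilityTheory
open scoped ENNReal

noncomputable section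

namespace SGD

/-- The Euclidean space `ℝ^d`. -/
abbrev E (d : ℕ) := EuclideanSpace ℝ (Fin d)

/-- `f` is continuously differentiable and `μ`-strongly convex on `ℝ^d`, with `μ > 0`. -/
structure StronglyConvex {d : ℕ} (f : E d → ℝ) (μ : ℝ) : Prop where
  pos : 0 < μ
  contDiff : ContDiff ℝ 1 f
  le : ∀ θ θ' : E d,
    μ / 2 * ‖θ - θ'‖ ^ 2 ≤ f θ - f θ' - inner ℝ (gradient f θ') (θ - θ')

/-- `f` is four times continuously differentiable, its gradient is `L₂`-Lipschitz, and its third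
and fourth derivatives are bounded by `L₃` and `L₄` (in operator norm). -/
structure Smooth {d : ℕ} (f : E d → ℝ) (L₂ L₃ L₄ : ℝ) : Prop where
  contDiff : ContDiff ℝ 4 f
  nonneg₂ : 0 ≤ L₂
  nonneg₃ : 0 ≤ L₃
  nonneg₄ : 0 ≤ L₄
  lipschitz : ∀ θ θ' : E d, ‖gradient f θ - gradient f θ'‖ ≤ L₂ * ‖θ - θ'‖
  third : ∀ θ : E d, ‖iteratedFDeriv ℝ 3 f θ‖ ≤ L₃
  fourth : ∀ θ : E d, ‖iteratedFDeriv ℝ 4 f θ‖ ≤ L₄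

/-- The noise assumption of order `p`: `gradF θ z` (the stochastic gradient `∇F(θ, z)`) is an
unbiased estimate of `∇f(θ)` when `z ∼ P`; it has an `L^p` norm at most `τ` at `θstar`; and it
satisfies the generalised `L₁`-co-coercivity inequality for every exponent `q = 2, …, p`.
Expectations of nonnegative quantities are taken in `[0, ∞]`, so that the bounds include the
finiteness of the moments. -/
structure NoiseAssumption (p : ℕ) {d : ℕ} {Z : Type*} [MeasurableSpace Z] (P : Measure Z)
    (f : E d → ℝ) (gradF : E d → Z → E d) (θstar : E d) (τ L₁ : ℝ) : Prop where
  integrable : ∀ θ : E d, Integrable (gradF θ) P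
  unbiased : ∀ θ : E d, ∫ z, gradF θ z ∂P = gradient f θ
  nonneg_τ : 0 ≤ τ
  moment : eLpNorm (gradF θstar) (p : ℝ≥0∞) P ≤ ENNReal.ofReal τ
  pos₁ : 0 < L₁
  cocoercive : ∀ q : ℕ, 2 ≤ q → q ≤ p → ∀ θ₁ θ₂ : E d,
    ∫⁻ z, ‖gradF θ₁ z - gradF θ₂ z‖ₑ ^ q ∂P ≤
      ENNReal.ofReal (L₁ ^ (q - 1) * ‖θ₁ - θ₂‖ ^ (q - 2) *
        inner ℝ (gradient f θ₁ - gradient f θ₂) (θ₁ - θ₂))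

section Kernel

variable {d : ℕ} {Z : Type*} [MeasurableSpace Z]

/-- The transition kernel of SGD with constant step size `γ`: `sgdKernel P gradF h γ θ` is the law
of `θ - γ ∇F(θ, z)` for `z ∼ P`. -/
def sgdKernel (P : Measure Z) [SFinite P] (gradF : E d → Z → E d)
    (hG : Measurable (Function.uncurry gradF)) (γ : ℝ) : Kernel (E d) (E d) where
  toFun θ := P.map (fun z => θ - γ • gradF θ z)
  measurable' := by
    have hm : Measurable (fun x : E d × Z => x.1 - γ • gradF x.1 x.2) :=
      measurable_fst.sub (hG.const_smul γ)
    refine Measure.measurable_of_measurable_coe _ fun A hA => ?_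
    have h : ∀ θ : E d, P.map (fun z => θ - γ • gradF θ z) A =
        P (Prod.mk θ ⁻¹' ((fun x : E d × Z => x.1 - γ • gradF x.1 x.2) ⁻¹' A)) := fun θ =>
      Measure.map_apply (hm.comp measurable_prodMk_left) hA
    simp only [h]
    exact measurable_measure_prodMk_left (hm hA)

variable (P : Measure Z) (gradF : E d → Z → E d) (hG : Measurable (Function.uncurry gradF)) (γ : ℝ)

/-- `Q_γ(θ, A) = ∫ 1_A(θ - γ ∇F(θ, z)) P(dz)`. -/
theorem sgdKernel_apply [SFinite P] (θ : E d) {A : Set (E d)} (hA : MeasurableSet A) :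
    sgdKernel P gradF hG γ θ A =
      ∫⁻ z, A.indicator (fun _ => (1 : ℝ≥0∞)) (θ - γ • gradF θ z) ∂P := by
  have hm : Measurable (fun z => θ - γ • gradF θ z) :=
    measurable_const.sub ((hG.comp measurable_prodMk_left).const_smul γ)
  change P.map (fun z => θ - γ • gradF θ z) A = _
  rw [← lintegral_map (f := A.indicator fun _ => (1 : ℝ≥0∞)) (measurable_const.indicator hA) hm,
    lintegral_indicator hA, setLIntegral_const, one_mul]

instance [IsProbabilityMeasure P] : IsMarkovKernel (sgdKernel P gradF hG γ) where
  isProbabilityMeasure θ := by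
    have hm : Measurable (fun z => θ - γ • gradF θ z) :=
      measurable_const.sub ((hG.comp measurable_prodMk_left).const_smul γ)
    exact Measure.isProbabilityMeasure_map hm.aemeasurable

end Kernel

/-- `C` is a coupling of `ν` and `ν'`: its marginals are `ν` and `ν'`. -/
def IsCoupling {X : Type*} [MeasurableSpace X] (C : Measure (X × X)) (ν ν' : Measure X) : Prop :=
  C.fst = ν ∧ C.snd = ν'

/-- The Wasserstein semi-metric of a cost function `c`, with values in `[0, ∞]`:
the infimum over all couplings of the integral of the cost. -/
def wasserstein {X : Type*} [MeasurableSpace X] (c : X → X → ℝ) (ν ν' : Measure X) : ℝ≥0∞ :=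
  ⨅ (C : Measure (X × X)) (_ : IsCoupling C ν ν'), ∫⁻ x, ENNReal.ofReal (c x.1 x.2) ∂C

/-- The distance-like function
`c(θ, θ') = ‖θ - θ'‖ (‖θ - θ*‖ + ‖θ' - θ*‖ + 2 √2 τ √γ / √μ)`. -/
def cost {d : ℕ} (θstar : E d) (τ γ μ : ℝ) (θ θ' : E d) : ℝ :=
  ‖θ - θ'‖ * (‖θ - θstar‖ + ‖θ' - θstar‖ + 2 * √2 * τ * √γ / √μ)

/-- `m(γ) = ⌈2 log 4 / (γ μ)⌉`. -/
def mixTime (γ μ : ℝ) : ℕ := ⌈2 * Real.log 4 / (γ * μ)⌉₊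

end SGD

end

namespace SGD

/-! Run two SGD chains with the same noise. Strong convexity and co-coercivity make one step
contract the mean squared distance by `ρ = max 0 (1 - γμ)` (`lintegral_step_sub_step_sq_le`).
Comparison with the minimizer, where the gradient vanishes, gives the drift `ρ ‖θ - θ*‖² + (1 - ρ)
β²` with `β = √2 τ √γ / √μ` (`lintegral_step_sub_star_sq_le`). Iterating, after `k` steps the
squared distance has mean at most `ρ^k ‖θ - θ'‖²`, and the squared distance of each chain to `θ*`
has mean at most `(‖θ - θ*‖ + β)²`.

The cost is a distance times a sum of distances to `θ*` and `2β`, so Cauchy-Schwarz turns these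
bounds into a contraction of its mean by `2 ρ^(k/2)` (`lintegral_enorm_sub_mul_le`). The choice of
`m(γ)` gives `ρ^(k/2) ≤ (1/2)^(k/m)`. Integrating against any initial coupling bounds the
Wasserstein cost (`wasserstein_bind_pow_le`).

Existence does not use completeness of a space of measures: the random map induces a contraction of
`L²` of an i.i.d. noise sequence, and its fixed point has an invariant law (`exists_invariant`).
Uniqueness follows from the same coupling (`invariant_unique`). -/

theorem isMarkovKernel_pow {X : Type*} [MeasurableSpace X] (κ : Kernel X X) [IsMarkovKernel κ]
    (k : ℕ) : IsMarkovKernel (κ ^ k) := by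
  induction k with
  | zero => rw [pow_zero]; exact inferInstanceAs (IsMarkovKernel Kernel.id)
  | succ k ih => rw [pow_succ]; exact inferInstanceAs (IsMarkovKernel ((κ ^ k) ∘ₖ κ))

/-- If a function decreases in mean by an affine contraction under one step of a Markov kernel,
then its mean after `k` steps is controlled. -/
theorem lintegral_pow_le {X : Type*} [MeasurableSpace X] (κ : Kernel X X) [IsMarkovKernel κ]
    {V : X → ℝ≥0∞} (hV : Measurable V) {r s B : ℝ≥0∞} (hrs : r + s = 1)
    (h : ∀ x, ∫⁻ y, V y ∂κ x ≤ r * V x + s * B) (k : ℕ) (x : X) :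
    ∫⁻ y, V y ∂(κ ^ k) x ≤ r ^ k * V x + B := by
  induction k with
  | zero =>
    rw [pow_zero, show (1 : Kernel X X) = Kernel.id from rfl, Kernel.id_apply,
      lintegral_dirac' _ hV]
    simp
  | succ k ih =>
    have hP := isMarkovKernel_pow κ k
    rw [pow_succ', show κ * κ ^ k = κ ∘ₖ (κ ^ k) from rfl, Kernel.lintegral_comp _ _ _ hV]
    calc ∫⁻ b, ∫⁻ c, V c ∂κ b ∂(κ ^ k) x ≤ ∫⁻ b, (r * V b + s * B) ∂(κ ^ k) x :=
          lintegral_mono h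
      _ = r * ∫⁻ b, V b ∂(κ ^ k) x + s * B := by
          rw [lintegral_add_right _ measurable_const, lintegral_const_mul _ hV]
          simp
      _ ≤ r * (r ^ k * V x + B) + s * B := by gcongr
      _ = r ^ (k + 1) * V x + (r + s) * B := by ring
      _ = _ := by rw [hrs, one_mul]

/-- Cauchy-Schwarz, with the second moments bounded by squares so that no roots appear later. -/
theorem lintegral_mul_le_of_sq_le {X : Type*} [MeasurableSpace X] (m : Measure X)
    {f g : X → ℝ≥0∞} (hf : AEMeasurable f m) (hg : AEMeasurable g m) {a b : ℝ≥0∞}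
    (hfa : ∫⁻ x, f x ^ 2 ∂m ≤ a ^ 2) (hgb : ∫⁻ x, g x ^ 2 ∂m ≤ b ^ 2) :
    ∫⁻ x, f x * g x ∂m ≤ a * b := by
  have key : ∀ (u : X → ℝ≥0∞) (c : ℝ≥0∞), ∫⁻ x, u x ^ 2 ∂m ≤ c ^ 2 →
      (∫⁻ x, u x ^ (2 : ℝ) ∂m) ^ (1 / 2 : ℝ) ≤ c := by
    intro u c h
    have : (∫⁻ x, u x ^ (2 : ℝ) ∂m) ^ (1 / 2 : ℝ) ≤ (c ^ (2 : ℝ)) ^ (1 / 2 : ℝ) := by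
      gcongr
      simpa using h
    rwa [← ENNReal.rpow_mul, show (2 : ℝ) * (1 / 2) = 1 by norm_num, ENNReal.rpow_one] at this
  calc ∫⁻ x, f x * g x ∂m
      ≤ (∫⁻ x, f x ^ (2 : ℝ) ∂m) ^ (1 / 2 : ℝ) * (∫⁻ x, g x ^ (2 : ℝ) ∂m) ^ (1 / 2 : ℝ) :=
        ENNReal.lintegral_mul_le_Lp_mul_Lq m Real.HolderConjugate.two_two hf hg
    _ ≤ a * b := mul_le_mul' (key f a hfa) (key g b hgb)

/-! ### Markov couplings, Wasserstein costs and uniqueness of the invariant law -/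

section Coupling

variable {X : Type*} [MeasurableSpace X]

theorem fst_bind {K : Kernel (X × X) (X × X)} {Q : Kernel X X}
    (h : ∀ x, (K x).fst = Q x.1) (C : Measure (X × X)) : (C.bind K).fst = C.fst.bind Q := by
  ext A hA
  rw [Measure.fst_apply hA, Measure.bind_apply (measurable_fst hA) K.aemeasurable,
    Measure.bind_apply hA Q.aemeasurable, Measure.fst,
    lintegral_map (Q.measurable_coe hA) measurable_fst]
  simp only [← h, Measure.fst_apply hA]

theorem snd_bind {K : Kernel (X × X) (X × X)} {Q : Kernel X X}
    (h : ∀ x, (K x).snd = Q x.2) (C : Measure (X × X)) : (C.bind K).snd = C.snd.bind Q := by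
  ext A hA
  rw [Measure.snd_apply hA, Measure.bind_apply (measurable_snd hA) K.aemeasurable,
    Measure.bind_apply hA Q.aemeasurable, Measure.snd,
    lintegral_map (Q.measurable_coe hA) measurable_snd]
  simp only [← h, Measure.snd_apply hA]

theorem bind_pow_zero (κ : Kernel X X) (m : Measure X) : m.bind (κ ^ 0 : Kernel X X) = m := by
  rw [pow_zero]
  exact Measure.bind_dirac

theorem bind_pow_succ (κ : Kernel X X) (m : Measure X) (k : ℕ) :
    m.bind (κ ^ (k + 1) : Kernel X X) = (m.bind (κ ^ k : Kernel X X)).bind κ := by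
  rw [pow_succ', show κ * κ ^ k = κ ∘ₖ (κ ^ k) from rfl, Measure.comp_assoc]

theorem isCoupling_bind_pow {K : Kernel (X × X) (X × X)} {Q : Kernel X X}
    (h₁ : ∀ x, (K x).fst = Q x.1) (h₂ : ∀ x, (K x).snd = Q x.2) {C : Measure (X × X)}
    {ν ν' : Measure X} (hC : IsCoupling C ν ν') (k : ℕ) :
    IsCoupling (C.bind (K ^ k : Kernel (X × X) (X × X))) (ν.bind (Q ^ k : Kernel X X))
      (ν'.bind (Q ^ k : Kernel X X)) := by
  induction k with
  | zero => simpa only [bind_pow_zero] using hC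
  | succ k ih =>
    simp only [bind_pow_succ]
    exact ⟨by rw [fst_bind h₁, ih.1], by rw [snd_bind h₂, ih.2]⟩

theorem invariant_pow {Q : Kernel X X} {m : Measure X} (h : Kernel.Invariant Q m) (k : ℕ) :
    m.bind (Q ^ k : Kernel X X) = m := by
  induction k with
  | zero => exact bind_pow_zero Q m
  | succ k ih => rw [bind_pow_succ, ih]; exact h

/-- Evolving a coupling by `K ^ k` gives an admissible coupling of the evolved laws, so a pointwise
bound on the mean cost integrates against every initial coupling. -/
theorem wasserstein_bind_pow_le {K : Kernel (X × X) (X × X)} {Q : Kernel X X}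
    (h₁ : ∀ x, (K x).fst = Q x.1) (h₂ : ∀ x, (K x).snd = Q x.2) {c : X → X → ℝ}
    (hc : Measurable (Function.uncurry c)) {a : ℝ≥0∞} (ha₀ : a ≠ 0) (ha : a ≠ ∞) (k : ℕ)
    (h : ∀ x, ∫⁻ y, ENNReal.ofReal (c y.1 y.2) ∂(K ^ k) x ≤ a * ENNReal.ofReal (c x.1 x.2))
    (ν ν' : Measure X) :
    wasserstein c (ν.bind (Q ^ k : Kernel X X)) (ν'.bind (Q ^ k : Kernel X X)) ≤
      a * wasserstein c ν ν' := by
  have hm : Measurable fun x : X × X => ENNReal.ofReal (c x.1 x.2) := hc.ennreal_ofReal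
  unfold wasserstein
  -- The infimum over proofs of `IsCoupling` is `∞` for a non-coupling, hence the need for `a ≠ 0`
  -- when the factor moves inside.
  rw [ENNReal.mul_iInf_of_ne ha₀ ha]
  refine le_iInf fun C => ?_
  rw [ENNReal.mul_iInf_of_ne ha₀ ha]
  refine le_iInf fun hC => ?_
  refine (iInf₂_le (C.bind (K ^ k : Kernel (X × X) (X × X)))
    (isCoupling_bind_pow h₁ h₂ hC k)).trans ?_
  rw [Measure.lintegral_bind (Kernel.aemeasurable _) hm.aemeasurable, ← lintegral_const_mul _ hm]
  exact lintegral_mono h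

end Coupling

/-- A Markov kernel with a self-coupling that contracts the mean squared distance has at most one
invariant probability measure. -/
theorem invariant_unique {X : Type*} [PseudoMetricSpace X] [MeasurableSpace X] [BorelSpace X]
    [SecondCountableTopology X] {K : Kernel (X × X) (X × X)} [IsMarkovKernel K] {Q : Kernel X X}
    (h₁ : ∀ x, (K x).fst = Q x.1) (h₂ : ∀ x, (K x).snd = Q x.2) {r : ℝ≥0∞} (hr : r < 1)
    (hK : ∀ x, ∫⁻ y, edist y.1 y.2 ^ 2 ∂K x ≤ r * edist x.1 x.2 ^ 2)
    (π π' : ProbabilityMeasure X) (hπ : Kernel.Invariant Q (π : Measure X))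
    (hπ' : Kernel.Invariant Q (π' : Measure X)) : π = π' := by
  have hd : Measurable fun y : X × X => edist y.1 y.2 := measurable_fst.edist measurable_snd
  set C : Measure (X × X) := (π : Measure X).prod π' with hCdef
  have hC : IsCoupling C (π : Measure X) π' := ⟨by simp [hCdef], by simp [hCdef]⟩
  have hCk := isCoupling_bind_pow h₁ h₂ hC
  simp only [invariant_pow hπ, invariant_pow hπ'] at hCk
  -- No second moment of `π` or `π'` is assumed, so Chebyshev is applied from each fixed starting
  -- pair, and dominated convergence (probabilities are at most `1`) integrates over `C`.
  have hsmall : ∀ ε : ℝ≥0∞, 0 < ε → ε < ∞ → Filter.Tendsto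
      (fun k : ℕ => C.bind (K ^ k : Kernel (X × X) (X × X)) {y | ε ≤ edist y.1 y.2})
      Filter.atTop (nhds 0) := by
    intro ε hε hε'
    have hS : MeasurableSet {y : X × X | ε ≤ edist y.1 y.2} :=
      measurableSet_le measurable_const hd
    simp only [Measure.bind_apply hS (Kernel.aemeasurable _)]
    rw [← lintegral_zero (μ := C)]
    refine tendsto_lintegral_of_dominated_convergence (fun _ => 1)
      (fun k => Kernel.measurable_coe _ hS) (fun k => ?_) (by simp) (ae_of_all _ fun x => ?_)
    · have := isMarkovKernel_pow K k
      exact ae_of_all _ fun x => prob_le_one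
    have hlim : Filter.Tendsto (fun k : ℕ => r ^ k * edist x.1 x.2 ^ 2 / ε ^ 2)
        Filter.atTop (nhds 0) := by
      have h0 := ENNReal.Tendsto.mul_const (b := edist x.1 x.2 ^ 2)
        (ENNReal.tendsto_pow_atTop_nhds_zero_of_lt_one hr)
        (Or.inr (ENNReal.pow_ne_top (edist_ne_top _ _)))
      have h1 := ENNReal.Tendsto.mul_const (b := (ε ^ 2)⁻¹) h0
        (Or.inr (ENNReal.inv_ne_top.2 (pow_ne_zero _ hε.ne')))
      simpa only [zero_mul, div_eq_mul_inv] using h1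
    refine tendsto_of_tendsto_of_tendsto_of_le_of_le tendsto_const_nhds hlim
      (fun _ => zero_le) fun k => ?_
    calc (K ^ k) x {y | ε ≤ edist y.1 y.2}
        ≤ (K ^ k) x {y | ε ^ 2 ≤ edist y.1 y.2 ^ 2} :=
          by
          refine measure_mono fun y hy => ?_
          rw [Set.mem_ofPred_eq] at hy ⊢
          gcongr
      _ ≤ (∫⁻ y, edist y.1 y.2 ^ 2 ∂(K ^ k) x) / ε ^ 2 :=
          meas_ge_le_lintegral_div (hd.pow_const 2).aemeasurable (pow_ne_zero _ hε.ne')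
            (ENNReal.pow_ne_top hε'.ne)
      _ ≤ r ^ k * edist x.1 x.2 ^ 2 / ε ^ 2 := by
          gcongr
          simpa using lintegral_pow_le K (hd.pow_const 2) (s := 1 - r) (B := 0)
            (add_tsub_cancel_of_le hr.le) (by simpa using hK) k x
  -- By invariance every evolved coupling still has marginals `π` and `π'`, while its mass off the
  -- `ε`-diagonal drops below `ε`.
  have hLP : levyProkhorovEDist (π : Measure X) π' = 0 := by
    refine le_antisymm (levyProkhorovEDist_le_of_forall_le _ _ 0 fun ε A hε hε' hA => ?_) zero_le
    obtain ⟨k, hk⟩ := ((hsmall ε hε hε').eventually (gt_mem_nhds hε)).exists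
    have hT : MeasurableSet (Metric.thickening ε.toReal A) := Metric.isOpen_thickening.measurableSet
    nth_rw 1 [← (hCk k).1]
    nth_rw 1 [← (hCk k).2]
    rw [Measure.fst_apply hA, Measure.snd_apply hT]
    refine le_trans ?_ (add_le_add_right hk.le _)
    refine (measure_mono fun y hy => ?_).trans (measure_union_le _ _)
    by_cases hy' : ε ≤ edist y.1 y.2
    · exact Or.inr hy'
    · refine Or.inl (Metric.mem_thickening_iff_exists_edist_lt _ _ |>.2 ⟨y.1, hy, ?_⟩)
      rw [ENNReal.ofReal_toReal hε'.ne, edist_comm]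
      exact not_le.1 hy'
  refine Subtype.ext (ext_of_generate_finite (μ := (π : Measure X)) (ν := (π' : Measure X)) _
    (BorelSpace.measurable_eq.trans borel_eq_generateFrom_isClosed) isPiSystem_isClosed
    (fun A hA => ?_) (by simp))
  exact measure_eq_measure_of_levyProkhorovEDist_eq_zero_of_isClosed hLP hA
    ⟨1, one_pos, measure_ne_top _ _⟩ ⟨1, one_pos, measure_ne_top _ _⟩

end SGD
namespace SGD

/-! ### Synchronous coupling and second moments of a random step -/

section Kernels

variable {Z : Type*} [MeasurableSpace Z]

/-- The law of `Φ x z` for `z ∼ P`, as a kernel in `x`. -/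
noncomputable def noiseKernel {X Y : Type*} [MeasurableSpace X] [MeasurableSpace Y] (P : Measure Z) [SFinite P]
    (Φ : X × Z → Y) : Kernel X Y :=
  (Kernel.id ×ₖ Kernel.const X P).map Φ

theorem noiseKernel_apply {X Y : Type*} [MeasurableSpace X] [MeasurableSpace Y] (P : Measure Z)
    [SFinite P] {Φ : X × Z → Y} (hΦ : Measurable Φ) (x : X) :
    noiseKernel P Φ x = P.map fun z => Φ (x, z) := by
  rw [noiseKernel, Kernel.map_apply _ hΦ, Kernel.prod_apply, Kernel.id_apply, Kernel.const_apply,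
    Measure.dirac_prod, Measure.map_map hΦ measurable_prodMk_left]
  rfl

variable {d : ℕ}

/-- One step of SGD from `x.1` with noise `x.2`. -/
noncomputable def step (gradF : E d → Z → E d) (γ : ℝ) (x : E d × Z) : E d := x.1 - γ • gradF x.1 x.2

/-- One step of SGD from two points with a common noise. -/
noncomputable def pairStep (gradF : E d → Z → E d) (γ : ℝ) (x : (E d × E d) × Z) : E d × E d :=
  (step gradF γ (x.1.1, x.2), step gradF γ (x.1.2, x.2))

variable {gradF : E d → Z → E d}

theorem measurable_step (hG : Measurable (Function.uncurry gradF)) (γ : ℝ) :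
    Measurable (step gradF γ) :=
  measurable_fst.sub (hG.const_smul γ)

theorem measurable_pairStep (hG : Measurable (Function.uncurry gradF)) (γ : ℝ) :
    Measurable (pairStep gradF γ) := by
  have := measurable_step hG γ
  unfold pairStep
  fun_prop

variable (P : Measure Z)

theorem lintegral_pairKernel [SFinite P] (hG : Measurable (Function.uncurry gradF)) (γ : ℝ)
    (x : E d × E d) {V : E d × E d → ℝ≥0∞} (hV : Measurable V) :
    ∫⁻ y, V y ∂noiseKernel P (pairStep gradF γ) x =
      ∫⁻ z, V (step gradF γ (x.1, z), step gradF γ (x.2, z)) ∂P := by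
  have hm := measurable_pairStep hG γ
  rw [noiseKernel_apply P hm, lintegral_map hV (by fun_prop)]
  rfl

theorem pairKernel_fst [SFinite P] (hG : Measurable (Function.uncurry gradF)) (γ : ℝ)
    (x : E d × E d) :
    (noiseKernel P (pairStep gradF γ) x).fst = sgdKernel P gradF hG γ x.1 := by
  have hm := measurable_pairStep hG γ
  rw [noiseKernel_apply P hm, Measure.fst, Measure.map_map measurable_fst (by fun_prop)]
  rfl

theorem pairKernel_snd [SFinite P] (hG : Measurable (Function.uncurry gradF)) (γ : ℝ)
    (x : E d × E d) :
    (noiseKernel P (pairStep gradF γ) x).snd = sgdKernel P gradF hG γ x.2 := by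
  have hm := measurable_pairStep hG γ
  rw [noiseKernel_apply P hm, Measure.snd, Measure.map_map measurable_snd (by fun_prop)]
  rfl

theorem isMarkovKernel_pairKernel [IsProbabilityMeasure P]
    (hG : Measurable (Function.uncurry gradF)) (γ : ℝ) :
    IsMarkovKernel (noiseKernel P (pairStep gradF γ)) :=
  Kernel.IsMarkovKernel.map _ (measurable_pairStep hG γ)

theorem enorm_sq_eq_ofReal {H : Type*} [SeminormedAddCommGroup H] (w : H) :
    ‖w‖ₑ ^ 2 = ENNReal.ofReal (‖w‖ ^ 2) := by
  rw [ENNReal.ofReal_pow (norm_nonneg _), ofReal_norm]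

/-- Expand the square: the cross term sees only the mean of `D`. The bound `hA` supplies the square
integrability needed to pass to real integrals. -/
theorem lintegral_enorm_sub_smul_sq_le {H : Type*} [NormedAddCommGroup H] [InnerProductSpace ℝ H]
    [CompleteSpace H] [IsProbabilityMeasure P] {D : Z → H} (hD : Integrable D P) {A : ℝ}
    (hA₀ : 0 ≤ A) (hA : ∫⁻ z, ‖D z‖ₑ ^ 2 ∂P ≤ ENNReal.ofReal A) (v : H) (γ : ℝ) :
    ∫⁻ z, ‖v - γ • D z‖ₑ ^ 2 ∂P ≤
      ENNReal.ofReal (‖v‖ ^ 2 - 2 * γ * inner ℝ (∫ z, D z ∂P) v + γ ^ 2 * A) := by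
  simp only [enorm_sq_eq_ofReal] at hA ⊢
  have hsq : Integrable (fun z => ‖D z‖ ^ 2) P :=
    ⟨(hD.aestronglyMeasurable.norm.pow 2), by
      rw [hasFiniteIntegral_iff_ofReal (ae_of_all _ fun z => sq_nonneg _)]
      exact hA.trans_lt ENNReal.ofReal_lt_top⟩
  have hin : Integrable (fun z => inner ℝ v (D z)) P := hD.const_inner v
  have hexp : ∀ z, ‖v - γ • D z‖ ^ 2 =
      (‖v‖ ^ 2 - 2 * γ * inner ℝ v (D z)) + γ ^ 2 * ‖D z‖ ^ 2 := fun z => by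
    rw [norm_sub_sq_real, inner_smul_right, norm_smul, mul_pow, Real.norm_eq_abs, sq_abs]
    ring
  have hint₁ : Integrable (fun z => ‖v‖ ^ 2 - 2 * γ * inner ℝ v (D z)) P :=
    (integrable_const _).sub (hin.const_mul _)
  have hint : Integrable (fun z => ‖v - γ • D z‖ ^ 2) P := by
    simp only [hexp]
    exact hint₁.add (hsq.const_mul _)
  rw [← ofReal_integral_eq_lintegral_ofReal hint (ae_of_all _ fun z => sq_nonneg _)]
  rw [← ofReal_integral_eq_lintegral_ofReal hsq (ae_of_all _ fun z => sq_nonneg _),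
    ENNReal.ofReal_le_ofReal_iff hA₀] at hA
  refine ENNReal.ofReal_le_ofReal ?_
  simp only [hexp]
  rw [integral_add hint₁ (hsq.const_mul _), integral_sub (integrable_const _) (hin.const_mul _),
    integral_const_mul, integral_const_mul, integral_inner hD, real_inner_comm]
  simp only [integral_const, probReal_univ, one_smul]
  gcongr

end Kernels

/-! ### Consequences of strong convexity -/

section Convex

variable {d : ℕ} {f : E d → ℝ} {μ : ℝ}

/-- Add the strong convexity inequality to the one with the points exchanged. -/
theorem StronglyConvex.le_inner (hf : StronglyConvex f μ) (θ θ' : E d) :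
    μ * ‖θ - θ'‖ ^ 2 ≤ inner ℝ (gradient f θ - gradient f θ') (θ - θ') := by
  have h₁ := hf.le θ θ'
  have h₂ := hf.le θ' θ
  rw [norm_sub_rev, ← neg_sub θ θ', inner_neg_right] at h₂
  rw [inner_sub_left]
  linarith

theorem gradient_eq_zero_of_forall_le {θstar : E d} (h : ∀ θ, f θstar ≤ f θ) :
    gradient f θstar = 0 := by
  have : IsLocalMin f θstar := Filter.Eventually.of_forall h
  rw [gradient, this.fderiv_eq_zero, map_zero]

/-- Monotonicity and the Lipschitz bound at a nonzero point force `μ ≤ L₂`. In dimension zero `μ` is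
unconstrained and this fails. -/
theorem mul_le_one_of_stronglyConvex [Nontrivial (E d)] (hf : StronglyConvex f μ) {L₂ γ : ℝ}
    (hL : ∀ θ θ' : E d, ‖gradient f θ - gradient f θ'‖ ≤ L₂ * ‖θ - θ'‖) (hγ₀ : 0 < γ)
    (hγ : γ * L₂ ≤ 1) : γ * μ ≤ 1 := by
  obtain ⟨θ, hθ⟩ := exists_ne (0 : E d)
  have h₁ := hf.le_inner θ 0
  have h₂ := (real_inner_le_norm (gradient f θ - gradient f 0) (θ - 0)).trans
    (mul_le_mul_of_nonneg_right (hL θ 0) (norm_nonneg _))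
  simp only [sub_zero] at h₁ h₂
  have hpos : 0 < ‖θ‖ ^ 2 := by positivity
  have : μ ≤ L₂ := le_of_mul_le_mul_right (by nlinarith) hpos
  nlinarith

end Convex

end SGD
namespace SGD

/-! ### One-step contraction and drift -/

section OneStep

variable {d : ℕ} {Z : Type*} [MeasurableSpace Z] {P : Measure Z} {f : E d → ℝ}
  {gradF : E d → Z → E d} {θstar : E d} {μ L₁ τ γ : ℝ}

theorem NoiseAssumption.lintegral_sub_sq_le (h : NoiseAssumption 2 P f gradF θstar τ L₁)
    (θ θ' : E d) : ∫⁻ z, ‖gradF θ z - gradF θ' z‖ₑ ^ 2 ∂P ≤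
      ENNReal.ofReal (L₁ * inner ℝ (gradient f θ - gradient f θ') (θ - θ')) := by
  simpa using h.cocoercive 2 le_rfl le_rfl θ θ'

theorem NoiseAssumption.lintegral_sq_le (h : NoiseAssumption 2 P f gradF θstar τ L₁) :
    ∫⁻ z, ‖gradF θstar z‖ₑ ^ 2 ∂P ≤ ENNReal.ofReal (τ ^ 2) := by
  have h₁ := h.moment
  rw [eLpNorm_eq_lintegral_rpow_enorm_toReal (by simp) (by simp)] at h₁
  have h₂ := pow_le_pow_left' h₁ 2
  rw [← ENNReal.ofReal_pow h.nonneg_τ, ← ENNReal.rpow_natCast, ← ENNReal.rpow_mul] at h₂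
  simpa using h₂

/-- Synchronously coupled SGD steps contract in mean square. -/
theorem lintegral_step_sub_step_sq_le [IsProbabilityMeasure P] (hf : StronglyConvex f μ)
    (h : NoiseAssumption 2 P f gradF θstar τ L₁) (hγ₀ : 0 < γ) (hγ : γ * L₁ ≤ 1 / 2)
    (θ θ' : E d) :
    ∫⁻ z, ‖step gradF γ (θ, z) - step gradF γ (θ', z)‖ₑ ^ 2 ∂P ≤
      ENNReal.ofReal (max 0 (1 - γ * μ)) * ‖θ - θ'‖ₑ ^ 2 := by
  have hI := hf.le_inner θ θ'
  have hμ := hf.pos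
  set I := inner ℝ (gradient f θ - gradient f θ') (θ - θ') with hIdef
  have hI₀ : 0 ≤ I := le_trans (by positivity) hI
  have key := lintegral_enorm_sub_smul_sq_le P ((h.integrable θ).sub (h.integrable θ'))
    (mul_nonneg h.pos₁.le hI₀) (h.lintegral_sub_sq_le θ θ') (θ - θ') γ
  rw [integral_sub' (h.integrable θ) (h.integrable θ'), h.unbiased, h.unbiased, ← hIdef] at key
  have hs : ∀ z, step gradF γ (θ, z) - step gradF γ (θ', z) =
      (θ - θ') - γ • (gradF θ - gradF θ') z := fun z => by
    simp only [step, Pi.sub_apply, smul_sub]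
    abel
  simp only [hs]
  refine key.trans ?_
  rw [enorm_sq_eq_ofReal, ← ENNReal.ofReal_mul (le_max_left _ _)]
  refine ENNReal.ofReal_le_ofReal ?_
  calc ‖θ - θ'‖ ^ 2 - 2 * γ * I + γ ^ 2 * (L₁ * I)
      = ‖θ - θ'‖ ^ 2 - γ * I * (2 - γ * L₁) := by ring
    _ ≤ ‖θ - θ'‖ ^ 2 - γ * I * 1 := by
        have : 0 ≤ γ * I := by positivity
        gcongr
        linarith
    _ ≤ (1 - γ * μ) * ‖θ - θ'‖ ^ 2 := by nlinarith
    _ ≤ _ := by gcongr; exact le_max_right _ _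

/-- The squared distance to the minimizer is a drift function for SGD. -/
theorem lintegral_step_sub_star_sq_le [IsProbabilityMeasure P] (hf : StronglyConvex f μ)
    (hθ : ∀ θ, f θstar ≤ f θ) (h : NoiseAssumption 2 P f gradF θstar τ L₁) (hγ₀ : 0 < γ)
    (hγ : γ * L₁ ≤ 1 / 2) (hγμ : Nontrivial (E d) → γ * μ ≤ 1) (θ : E d) :
    ∫⁻ z, ‖step gradF γ (θ, z) - θstar‖ₑ ^ 2 ∂P ≤
      ENNReal.ofReal (max 0 (1 - γ * μ)) * ‖θ - θstar‖ₑ ^ 2 +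
        (1 - ENNReal.ofReal (max 0 (1 - γ * μ))) * ENNReal.ofReal (√2 * τ * √γ / √μ) ^ 2 := by
  -- In dimension zero `γ * μ` may exceed `1`, but all distances vanish.
  rcases subsingleton_or_nontrivial (E d) with hE | hE
  · have : ∀ w : E d, ‖w‖ₑ ^ 2 = 0 := fun w => by simp [Subsingleton.elim w 0]
    simp [this]
  replace hγμ := hγμ hE
  have hμ := hf.pos
  have hI := hf.le_inner θ θstar
  have hJ := h.lintegral_sub_sq_le θ θstar
  rw [gradient_eq_zero_of_forall_le hθ, sub_zero] at hI hJ
  set I := inner ℝ (gradient f θ) (θ - θstar) with hIdef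
  have hI₀ : 0 ≤ I := le_trans (by positivity) hI
  have hL := h.pos₁
  have hA : ∫⁻ z, ‖gradF θ z‖ₑ ^ 2 ∂P ≤ ENNReal.ofReal (2 * (L₁ * I) + 2 * τ ^ 2) := by
    have hmeas : AEMeasurable (fun z => 2 * ‖gradF θstar z‖ₑ ^ 2) P :=
      ((h.integrable θstar).aestronglyMeasurable.enorm.pow_const 2).const_mul 2
    calc ∫⁻ z, ‖gradF θ z‖ₑ ^ 2 ∂P
        ≤ ∫⁻ z, (2 * ‖gradF θ z - gradF θstar z‖ₑ ^ 2 + 2 * ‖gradF θstar z‖ₑ ^ 2) ∂P := by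
          refine lintegral_mono fun z => ?_
          simp only [enorm_sq_eq_ofReal]
          have htwo : ∀ t : ℝ, 2 * ENNReal.ofReal t = ENNReal.ofReal (2 * t) := fun t => by
            rw [ENNReal.ofReal_mul zero_le_two, ENNReal.ofReal_ofNat]
          rw [htwo, htwo, ← ENNReal.ofReal_add (by positivity) (by positivity)]
          refine ENNReal.ofReal_le_ofReal ?_
          have h₁ : ‖gradF θ z‖ ≤ ‖gradF θ z - gradF θstar z‖ + ‖gradF θstar z‖ := by
            simpa using norm_add_le (gradF θ z - gradF θstar z) (gradF θstar z)
          have h₂ := pow_le_pow_left₀ (norm_nonneg _) h₁ 2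
          nlinarith [sq_nonneg (‖gradF θ z - gradF θstar z‖ - ‖gradF θstar z‖)]
      _ = 2 * ∫⁻ z, ‖gradF θ z - gradF θstar z‖ₑ ^ 2 ∂P + 2 * ∫⁻ z, ‖gradF θstar z‖ₑ ^ 2 ∂P := by
          rw [lintegral_add_right' _ hmeas, lintegral_const_mul' _ _ (by simp),
            lintegral_const_mul' _ _ (by simp)]
      _ ≤ 2 * ENNReal.ofReal (L₁ * I) + 2 * ENNReal.ofReal (τ ^ 2) := by
          gcongr
          exact h.lintegral_sq_le
      _ = _ := by
          rw [ENNReal.ofReal_add (by positivity) (by positivity), ENNReal.ofReal_mul zero_le_two,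
            ENNReal.ofReal_mul zero_le_two, ENNReal.ofReal_ofNat]
  have key := lintegral_enorm_sub_smul_sq_le P (h.integrable θ) (by positivity) hA (θ - θstar) γ
  rw [h.unbiased, ← hIdef] at key
  have hs : ∀ z, step gradF γ (θ, z) - θstar = (θ - θstar) - γ • gradF θ z := fun z => by
    simp only [step]
    abel
  simp only [hs]
  refine key.trans ?_
  have hτ := h.nonneg_τ
  rw [max_eq_right (by linarith), enorm_sq_eq_ofReal, ← ENNReal.ofReal_one,
    ← ENNReal.ofReal_sub _ (by linarith), ← ENNReal.ofReal_pow (by positivity),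
    ← ENNReal.ofReal_mul (by linarith), ← ENNReal.ofReal_mul (by linarith [mul_pos hγ₀ hμ]),
    ← ENNReal.ofReal_add (mul_nonneg (by linarith) (sq_nonneg _))
      (mul_nonneg (by linarith [mul_pos hγ₀ hμ]) (sq_nonneg _))]
  refine ENNReal.ofReal_le_ofReal ?_
  -- This identity fixes the constant in the cost: `γμ β²` is exactly the noise term `2γ²τ²`.
  have hb : (1 - (1 - γ * μ)) * (√2 * τ * √γ / √μ) ^ 2 = 2 * γ ^ 2 * τ ^ 2 := by
    rw [div_pow, mul_pow, mul_pow, Real.sq_sqrt zero_le_two, Real.sq_sqrt hγ₀.le,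
      Real.sq_sqrt hμ.le]
    field_simp
    ring
  rw [hb]
  -- The full restriction `γ L₁ ≤ 1/2` is used here: half of the cross term `2γI` absorbs `2γ²L₁I`,
  -- and the other half yields `γμ`.
  have h₁ : γ * I * (2 * (γ * L₁)) ≤ γ * I * 1 := by
    gcongr
    linarith
  nlinarith

end OneStep

/-! ### Contraction of the cost by Cauchy-Schwarz -/

section Cost

variable {H : Type*} [NormedAddCommGroup H] [MeasurableSpace H] [BorelSpace H]
  [SecondCountableTopology H]

/-- If two coupled chains contract in mean square and have controlled second moments around `a`,
then the expected cost `‖x - y‖ (‖x - a‖ + ‖y - a‖ + 2 β)` contracts. -/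
theorem lintegral_enorm_sub_mul_le (m : Measure (H × H)) [IsProbabilityMeasure m] (a : H)
    (x : H × H) {q β : ℝ≥0∞}
    (h : ∫⁻ y, ‖y.1 - y.2‖ₑ ^ 2 ∂m ≤ (q * ‖x.1 - x.2‖ₑ) ^ 2)
    (h₁ : ∫⁻ y, ‖y.1 - a‖ₑ ^ 2 ∂m ≤ (‖x.1 - a‖ₑ + β) ^ 2)
    (h₂ : ∫⁻ y, ‖y.2 - a‖ₑ ^ 2 ∂m ≤ (‖x.2 - a‖ₑ + β) ^ 2) :
    ∫⁻ y, ‖y.1 - y.2‖ₑ * (‖y.1 - a‖ₑ + ‖y.2 - a‖ₑ + 2 * β) ∂m ≤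
      2 * q * (‖x.1 - x.2‖ₑ * (‖x.1 - a‖ₑ + ‖x.2 - a‖ₑ + 2 * β)) := by
  have m₀ : Measurable fun y : H × H => ‖y.1 - y.2‖ₑ := by fun_prop
  have m₁ : Measurable fun y : H × H => ‖y.1 - a‖ₑ := by fun_prop
  have m₂ : Measurable fun y : H × H => ‖y.2 - a‖ₑ := by fun_prop
  have c₁ := lintegral_mul_le_of_sq_le m m₀.aemeasurable m₁.aemeasurable h h₁
  have c₂ := lintegral_mul_le_of_sq_le m m₀.aemeasurable m₂.aemeasurable h h₂
  have c₃ := lintegral_mul_le_of_sq_le m m₀.aemeasurable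
    (aemeasurable_const (b := 2 * β)) (b := 2 * β) h (by simp)
  simp only [mul_add]
  rw [lintegral_add_left (by fun_prop), lintegral_add_left (by fun_prop)]
  refine (add_le_add (add_le_add c₁ c₂) c₃).trans ?_
  -- The moment bounds add `2 * β` to the `2 * β` already in the cost; the factor `2` in the
  -- conclusion pays for this.
  calc q * ‖x.1 - x.2‖ₑ * (‖x.1 - a‖ₑ + β) + q * ‖x.1 - x.2‖ₑ * (‖x.2 - a‖ₑ + β) +
        q * ‖x.1 - x.2‖ₑ * (2 * β)
      = q * ‖x.1 - x.2‖ₑ * (‖x.1 - a‖ₑ + ‖x.2 - a‖ₑ + 4 * β) := by ring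
    _ ≤ q * ‖x.1 - x.2‖ₑ * (2 * ‖x.1 - a‖ₑ + 2 * ‖x.2 - a‖ₑ + 4 * β) := by
        gcongr <;> exact le_mul_of_one_le_left zero_le one_le_two
    _ = _ := by ring

end Cost

/-! ### The exponential rate -/

section Rate

/-- Use `1 - t ≤ exp (-t)` and compare exponents: only `2 log 2 / m ≤ γμ` is needed, while `m ≥ 4
log 2 / (γμ)`. -/
theorem pow_le_half_rpow_sq {γ μ : ℝ} (hγ : 0 < γ) (hμ : 0 < μ) (k : ℕ) :
    (max 0 (1 - γ * μ)) ^ k ≤ ((1 / 2 : ℝ) ^ ((k : ℝ) / (mixTime γ μ : ℝ))) ^ 2 := by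
  have hm : 2 * Real.log 4 / (γ * μ) ≤ mixTime γ μ := Nat.le_ceil _
  have hγμ : 0 < γ * μ := mul_pos hγ hμ
  have hlog : Real.log 4 = 2 * Real.log 2 := by
    rw [show (4 : ℝ) = 2 ^ 2 by norm_num, Real.log_pow]
    norm_num
  have hlog₂ : 0 < Real.log 2 := Real.log_pos one_lt_two
  rw [div_le_iff₀ hγμ, hlog] at hm
  have hm₀ : 0 < (mixTime γ μ : ℝ) := by
    by_contra hneg
    nlinarith
  have hbase : max 0 (1 - γ * μ) ≤ Real.exp (-(γ * μ)) :=
    max_le (Real.exp_pos _).le (by linarith [Real.add_one_le_exp (-(γ * μ))])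
  refine (pow_le_pow_left₀ (le_max_left _ _) hbase k).trans ?_
  rw [Real.rpow_def_of_pos (by norm_num), ← Real.exp_nat_mul, ← Real.exp_nat_mul, Real.exp_le_exp,
    one_div, Real.log_inv]
  have h₁ : Real.log 2 * 2 / mixTime γ μ ≤ γ * μ := by
    rw [div_le_iff₀ hm₀]
    nlinarith
  calc (k : ℝ) * -(γ * μ) ≤ k * -(Real.log 2 * 2 / mixTime γ μ) := by gcongr
    _ = _ := by push_cast; ring

end Rate

end SGD
namespace SGD

/-! ### Existence of an invariant law -/

section Existence

variable {Z : Type*} [MeasurableSpace Z]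

/-- Splitting off the first coordinate of an i.i.d. sequence. -/
theorem measurePreserving_tail_head (P : Measure Z) [IsProbabilityMeasure P] :
    MeasurePreserving (fun ω : ℕ → Z => ((fun n => ω (n + 1)), ω 0))
      (Measure.infinitePi fun _ => P) ((Measure.infinitePi fun _ => P).prod P) := by
  classical
  have hs : Measurable (fun ω : ℕ → Z => ((fun n => ω (n + 1)), ω 0)) := by fun_prop
  refine ⟨hs, ?_⟩
  -- Splitting undoes `cons`, so it suffices that `cons` sends the product law to the i.i.d. law,
  -- which is checked on finite boxes.
  let cons : (ℕ → Z) × Z → ℕ → Z := fun x n => Nat.casesOn n x.2 x.1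
  have hc : Measurable cons := by
    refine measurable_pi_lambda _ fun n => ?_
    cases n with
    | zero => exact measurable_snd
    | succ n => exact (measurable_pi_apply n).comp measurable_fst
  have hmap : ((Measure.infinitePi fun _ : ℕ => P).prod P).map cons =
      Measure.infinitePi fun _ => P := by
    refine Measure.eq_infinitePi _ fun s t ht => ?_
    have hinj : Set.InjOn Nat.succ (Nat.succ ⁻¹' (s : Set ℕ)) := Nat.succ_injective.injOn
    have hpre : cons ⁻¹' Set.pi s t =
        (Set.pi (s.preimage Nat.succ hinj) fun n => t (n + 1)) ×ˢ
          (if 0 ∈ s then t 0 else Set.univ) := by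
      ext ⟨ω, z⟩
      simp only [Set.mem_preimage, Set.mem_pi, Set.mem_prod, Finset.coe_preimage, Finset.mem_coe]
      constructor
      · intro h
        refine ⟨fun n hn => h (n + 1) hn, ?_⟩
        split_ifs with h0
        · exact h 0 h0
        · trivial
      · rintro ⟨h, h'⟩ n hn
        cases n with
        | zero => rwa [if_pos hn] at h'
        | succ n => exact h n hn
    rw [Measure.map_apply hc (MeasurableSet.pi s.countable_toSet fun i _ => ht i), hpre,
      Measure.prod_prod, Measure.infinitePi_pi _ (fun i _ => ht _),
      Finset.prod_preimage' Nat.succ s hinj fun n => P (t n)]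
    have hfilter : {x ∈ s | x ∈ Set.range Nat.succ} = s.erase 0 := by
      ext n
      simp only [Finset.mem_filter, Finset.mem_erase, Nat.range_succ, Set.mem_ofPred_eq]
      constructor
      · exact fun h => ⟨h.2.ne', h.1⟩
      · exact fun h => ⟨h.2, Nat.pos_of_ne_zero h.1⟩
    rw [hfilter]
    by_cases h0 : 0 ∈ s
    · rw [if_pos h0, mul_comm, Finset.mul_prod_erase s (fun n => P (t n)) h0]
    · rw [if_neg h0, measure_univ, mul_one, Finset.erase_eq_of_notMem h0]
  calc (Measure.infinitePi fun _ : ℕ => P).map (fun ω : ℕ → Z => ((fun n => ω (n + 1)), ω 0))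
      = ((Measure.infinitePi fun _ : ℕ => P).prod P).map
          ((fun ω : ℕ → Z => ((fun n => ω (n + 1)), ω 0)) ∘ cons) := by
        rw [← Measure.map_map hs hc, hmap]
    _ = _ := Measure.map_id

theorem eLpNorm_two_sq {H : Type*} [NormedAddCommGroup H] {Ω : Type*} [MeasurableSpace Ω]
    (m : Measure Ω) (X : Ω → H) : eLpNorm X 2 m ^ 2 = ∫⁻ ω, ‖X ω‖ₑ ^ 2 ∂m := by
  rw [eLpNorm_eq_lintegral_rpow_enorm_toReal (by simp) (by simp), ← ENNReal.rpow_natCast,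
    ← ENNReal.rpow_mul]
  simp

/-- A random map that contracts in mean square and preserves finiteness of second moments has an
invariant probability measure: the law of the fixed point of the induced contraction of `L²`. -/
theorem exists_invariant {H : Type*} [NormedAddCommGroup H] [MeasurableSpace H] [BorelSpace H]
    [SecondCountableTopology H] [CompleteSpace H] (P : Measure Z) [IsProbabilityMeasure P]
    {Φ : H × Z → H} (hΦ : Measurable Φ) {r : NNReal} (hr : r < 1) (a : H) {B : ℝ≥0∞} (hB : B ≠ ∞)
    (hmoment : ∀ x, ∫⁻ z, ‖Φ (x, z) - a‖ₑ ^ 2 ∂P ≤ r * ‖x - a‖ₑ ^ 2 + B)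
    (hcontr : ∀ x y, ∫⁻ z, ‖Φ (x, z) - Φ (y, z)‖ₑ ^ 2 ∂P ≤ r * ‖x - y‖ₑ ^ 2) :
    ∃ π : ProbabilityMeasure H, Kernel.Invariant (noiseKernel P Φ) (π : Measure H) := by
  set m : Measure (ℕ → Z) := Measure.infinitePi fun _ => P
  have hshift := measurePreserving_tail_head P
  have hint : ∀ {V : (ℕ → Z) × Z → ℝ≥0∞}, Measurable V →
      ∫⁻ ω, V ((fun n => ω (n + 1)), ω 0) ∂m = ∫⁻ ω, ∫⁻ z, V (ω, z) ∂P ∂m := fun {V} hV => by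
    rw [hshift.lintegral_comp hV, lintegral_prod _ hV.aemeasurable]
  -- The noise `ω 0` is independent of the shifted sequence, which has the law of `ω`; hence `S X`
  -- has the law of one Markov step started from the law of `X`.
  let S : ((ℕ → Z) → H) → (ℕ → Z) → H := fun X ω => Φ (X (fun n => ω (n + 1)), ω 0)
  have hSm : ∀ {X : (ℕ → Z) → H}, Measurable X → Measurable (S X) := fun {X} hX =>
    hΦ.comp ((hX.comp (by fun_prop)).prodMk (by fun_prop))
  have hmeas : ∀ X : Lp H 2 m, Measurable X := fun X => (Lp.stronglyMeasurable X).measurable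
  have hmem : ∀ X : Lp H 2 m, MemLp (S X) 2 m := by
    intro X
    have hX := hmeas X
    have ha : MemLp (fun _ : ℕ → Z => a) 2 m := memLp_const a
    have hXa : ∫⁻ ω, ‖X ω - a‖ₑ ^ 2 ∂m < ∞ := by
      rw [← eLpNorm_two_sq]
      exact ENNReal.pow_lt_top ((Lp.memLp X).sub ha).eLpNorm_lt_top
    have hle : ∫⁻ ω, ‖S X ω - a‖ₑ ^ 2 ∂m < ∞ := by
      calc ∫⁻ ω, ‖S X ω - a‖ₑ ^ 2 ∂m = ∫⁻ ω, ∫⁻ z, ‖Φ (X ω, z) - a‖ₑ ^ 2 ∂P ∂m :=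
            hint (V := fun x => ‖Φ (X x.1, x.2) - a‖ₑ ^ 2) (by fun_prop)
        _ ≤ ∫⁻ ω, (r * ‖X ω - a‖ₑ ^ 2 + B) ∂m := lintegral_mono fun ω => hmoment _
        _ = r * ∫⁻ ω, ‖X ω - a‖ₑ ^ 2 ∂m + B := by
            rw [lintegral_add_right _ measurable_const, lintegral_const_mul _ (by fun_prop)]
            simp
        _ < ∞ := ENNReal.add_lt_top.2 ⟨ENNReal.mul_lt_top ENNReal.coe_lt_top hXa, hB.lt_top⟩
    have hsub : MemLp (fun ω => S X ω - a) 2 m := by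
      refine ⟨((hSm hX).sub_const a).aestronglyMeasurable, ?_⟩
      rw [← eLpNorm_two_sq] at hle
      exact lt_top_iff_ne_top.2 fun htop => by simp [htop] at hle
    have hadd := hsub.add ha
    refine hadd.ae_eq (ae_of_all _ fun ω => ?_)
    simp
  let T : Lp H 2 m → Lp H 2 m := fun X => (hmem X).toLp (S X)
  have hT : ContractingWith (NNReal.sqrt r) T := by
    refine ⟨by simpa using NNReal.sqrt_lt_sqrt.2 hr, fun X Y => ?_⟩
    have hX := hmeas X
    have hY := hmeas Y
    rw [← ENNReal.pow_le_pow_left_iff two_ne_zero, mul_pow, ← ENNReal.coe_pow, NNReal.sq_sqrt,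
      Lp.edist_toLp_toLp, Lp.edist_def, eLpNorm_two_sq, eLpNorm_two_sq]
    calc ∫⁻ ω, ‖(S X - S Y) ω‖ₑ ^ 2 ∂m
        = ∫⁻ ω, ∫⁻ z, ‖Φ (X ω, z) - Φ (Y ω, z)‖ₑ ^ 2 ∂P ∂m :=
          hint (V := fun x => ‖Φ (X x.1, x.2) - Φ (Y x.1, x.2)‖ₑ ^ 2) (by fun_prop)
      _ ≤ ∫⁻ ω, r * ‖X ω - Y ω‖ₑ ^ 2 ∂m := lintegral_mono fun ω => hcontr _ _
      _ = _ := lintegral_const_mul _ (by fun_prop)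
  obtain ⟨X, hX, -⟩ := hT.exists_fixedPoint (0 : Lp H 2 m) (edist_ne_top _ _)
  have hXm := hmeas X
  have hae : S X =ᵐ[m] X := by
    have := (hmem X).coeFn_toLp
    rw [show (hmem X).toLp (S X) = X from hX] at this
    exact this.symm
  refine ⟨⟨m.map X, Measure.isProbabilityMeasure_map hXm.aemeasurable⟩, ?_⟩
  -- The left side is the law of `S X`, and `S X = X` almost everywhere.
  change (m.map X).bind (noiseKernel P Φ) = m.map X
  ext A hA
  have hind : Measurable (A.indicator (1 : H → ℝ≥0∞)) := measurable_one.indicator hA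
  rw [Measure.bind_apply hA (Kernel.aemeasurable _),
    lintegral_map (Kernel.measurable_coe _ hA) hXm, ← Measure.map_congr hae,
    ← lintegral_indicator_one hA, lintegral_map hind (hSm hXm)]
  refine Eq.trans ?_ (hint (V := fun x => A.indicator 1 (Φ (X x.1, x.2)))
    (hind.comp (by fun_prop))).symm
  refine lintegral_congr fun ω => ?_
  rw [← lintegral_indicator_one hA, noiseKernel_apply P hΦ]
  exact lintegral_map hind (by fun_prop)

theorem sgdKernel_eq_noiseKernel {d : ℕ} (P : Measure Z) [SFinite P] {gradF : E d → Z → E d}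
    (hG : Measurable (Function.uncurry gradF)) (γ : ℝ) :
    sgdKernel P gradF hG γ = noiseKernel P (step gradF γ) := by
  refine Kernel.ext fun θ => ?_
  rw [noiseKernel_apply P (measurable_step hG γ)]
  rfl

end Existence

end SGD

/-! ### The cost in extended form, and the main theorem -/

namespace SGD

theorem measurable_cost {d : ℕ} (θstar : E d) (τ γ μ : ℝ) :
    Measurable (Function.uncurry (cost θstar τ γ μ)) := by
  unfold cost Function.uncurry
  fun_prop

theorem ofReal_cost {d : ℕ} (θstar : E d) {τ γ μ : ℝ} (hτ : 0 ≤ τ) (θ θ' : E d) :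
    ENNReal.ofReal (cost θstar τ γ μ θ θ') =
      ‖θ - θ'‖ₑ * (‖θ - θstar‖ₑ + ‖θ' - θstar‖ₑ +
        2 * ENNReal.ofReal (√2 * τ * √γ / √μ)) := by
  have hb : 0 ≤ √2 * τ * √γ / √μ := by positivity
  have h2 : 2 * √2 * τ * √γ / √μ = 2 * (√2 * τ * √γ / √μ) := by ring
  rw [cost, h2, ENNReal.ofReal_mul (norm_nonneg _), ENNReal.ofReal_add (by positivity)
    (by positivity), ENNReal.ofReal_add (norm_nonneg _) (norm_nonneg _),
    ENNReal.ofReal_mul zero_le_two, ENNReal.ofReal_ofNat]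
  simp only [ofReal_norm]

end SGD

theorem mainTheorem5 {d : ℕ} {Z : Type*} [MeasurableSpace Z]
    (P : Measure Z) [IsProbabilityMeasure P]
    (f : SGD.E d → ℝ) (gradF : SGD.E d → Z → SGD.E d)
    (hG : Measurable (Function.uncurry gradF))
    (θstar : SGD.E d) (hθstar : ∀ θ : SGD.E d, f θstar ≤ f θ)
    (μ L₁ L₂ L₃ L₄ τ₂ : ℝ)
    (hconvex : SGD.StronglyConvex f μ)
    (hsmooth : SGD.Smooth f L₂ L₃ L₄)
    (hnoise : SGD.NoiseAssumption 2 P f gradF θstar τ₂ L₁)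
    (L : ℝ) (hL : L = max (max L₁ L₂) (max L₃ L₄))
    (γ : ℝ) (hγ₀ : 0 < γ) (hγ : γ ≤ 1 / (2 * L)) :
    (∃! π : ProbabilityMeasure (SGD.E d),
      Kernel.Invariant (SGD.sgdKernel P gradF hG γ) (π : Measure (SGD.E d))) ∧
    ∀ π : ProbabilityMeasure (SGD.E d),
      Kernel.Invariant (SGD.sgdKernel P gradF hG γ) (π : Measure (SGD.E d)) →
      ∀ (ν : ProbabilityMeasure (SGD.E d)) (k : ℕ),
        SGD.wasserstein (SGD.cost θstar τ₂ γ μ)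
            ((ν : Measure (SGD.E d)).bind ((SGD.sgdKernel P gradF hG γ : Kernel (SGD.E d) (SGD.E d)) ^ k : Kernel (SGD.E d) (SGD.E d))) π ≤
          ENNReal.ofReal (4 * (1 / 2 : ℝ) ^ ((k : ℝ) / (SGD.mixTime γ μ : ℝ))) *
            SGD.wasserstein (SGD.cost θstar τ₂ γ μ) ν π := by
  have hL₁ : L₁ ≤ L := hL ▸ (le_max_left _ _).trans (le_max_left _ _)
  have hL₂ : L₂ ≤ L := hL ▸ (le_max_right _ _).trans (le_max_left _ _)
  have hL₀ : 0 < L := hnoise.pos₁.trans_le hL₁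
  have hγL : γ * L ≤ 1 / 2 := by
    rw [le_div_iff₀ (by positivity)] at hγ
    linarith
  have hγ₁ : γ * L₁ ≤ 1 / 2 := (mul_le_mul_of_nonneg_left hL₁ hγ₀.le).trans hγL
  have hγ₂ : γ * L₂ ≤ 1 := by linarith [mul_le_mul_of_nonneg_left hL₂ hγ₀.le]
  have hμ := hconvex.pos
  -- The truncation at `0` matters only in dimension zero.
  set ρ : ℝ := max 0 (1 - γ * μ)
  have hρ₀ : 0 ≤ ρ := le_max_left _ _
  have hρ₁ : ρ < 1 := max_lt one_pos (by linarith [mul_pos hγ₀ hμ])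
  have hr : ENNReal.ofReal ρ < 1 := ENNReal.ofReal_lt_one.2 hρ₁
  set β : ℝ≥0∞ := ENNReal.ofReal (√2 * τ₂ * √γ / √μ) with hβ
  have hcontr : ∀ θ θ' : SGD.E d,
      ∫⁻ z, ‖SGD.step gradF γ (θ, z) - SGD.step gradF γ (θ', z)‖ₑ ^ 2 ∂P ≤
        ENNReal.ofReal ρ * ‖θ - θ'‖ₑ ^ 2 :=
    SGD.lintegral_step_sub_step_sq_le hconvex hnoise hγ₀ hγ₁
  have hdrift : ∀ θ : SGD.E d, ∫⁻ z, ‖SGD.step gradF γ (θ, z) - θstar‖ₑ ^ 2 ∂P ≤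
      ENNReal.ofReal ρ * ‖θ - θstar‖ₑ ^ 2 + (1 - ENNReal.ofReal ρ) * β ^ 2 :=
    SGD.lintegral_step_sub_star_sq_le hconvex hθstar hnoise hγ₀ hγ₁ fun _ =>
      SGD.mul_le_one_of_stronglyConvex hconvex hsmooth.lipschitz hγ₀ hγ₂
  set K := SGD.noiseKernel P (SGD.pairStep gradF γ)
  have hKm : IsMarkovKernel K := SGD.isMarkovKernel_pairKernel P hG γ
  have hfst := SGD.pairKernel_fst P hG γ
  have hsnd := SGD.pairKernel_snd P hG γ
  have m₀ : Measurable fun y : SGD.E d × SGD.E d => ‖y.1 - y.2‖ₑ ^ 2 := by fun_prop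
  have m₁ : Measurable fun y : SGD.E d × SGD.E d => ‖y.1 - θstar‖ₑ ^ 2 := by fun_prop
  have m₂ : Measurable fun y : SGD.E d × SGD.E d => ‖y.2 - θstar‖ₑ ^ 2 := by fun_prop
  have k₀ : ∀ x, ∫⁻ y, ‖y.1 - y.2‖ₑ ^ 2 ∂K x ≤ ENNReal.ofReal ρ * ‖x.1 - x.2‖ₑ ^ 2 := fun x =>
    (SGD.lintegral_pairKernel P hG γ x m₀).trans_le (hcontr _ _)
  have k₁ : ∀ x, ∫⁻ y, ‖y.1 - θstar‖ₑ ^ 2 ∂K x ≤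
      ENNReal.ofReal ρ * ‖x.1 - θstar‖ₑ ^ 2 + (1 - ENNReal.ofReal ρ) * β ^ 2 := fun x =>
    (SGD.lintegral_pairKernel P hG γ x m₁).trans_le (hdrift _)
  have k₂ : ∀ x, ∫⁻ y, ‖y.2 - θstar‖ₑ ^ 2 ∂K x ≤
      ENNReal.ofReal ρ * ‖x.2 - θstar‖ₑ ^ 2 + (1 - ENNReal.ofReal ρ) * β ^ 2 := fun x =>
    (SGD.lintegral_pairKernel P hG γ x m₂).trans_le (hdrift _)
  refine ⟨?_, fun π hπ ν k => ?_⟩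
  · obtain ⟨π, hπ⟩ := SGD.exists_invariant P (SGD.measurable_step hG γ) (r := ρ.toNNReal)
      (Real.toNNReal_lt_one.2 hρ₁) θstar
      (ENNReal.mul_ne_top (by simp) (by simp [hβ])) hdrift hcontr
    rw [← SGD.sgdKernel_eq_noiseKernel P hG γ] at hπ
    refine ⟨π, hπ, fun π' hπ' => ?_⟩
    exact SGD.invariant_unique hfst hsnd hr (by simpa only [edist_eq_enorm_sub] using k₀) π' π
      hπ' hπ
  · set q : ℝ := (1 / 2 : ℝ) ^ ((k : ℝ) / (SGD.mixTime γ μ : ℝ))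
    have hq₀ : 0 < q := by positivity
    have hρq : ENNReal.ofReal ρ ^ k ≤ ENNReal.ofReal q ^ 2 := by
      rw [← ENNReal.ofReal_pow hρ₀, ← ENNReal.ofReal_pow hq₀.le]
      exact ENNReal.ofReal_le_ofReal (SGD.pow_le_half_rpow_sq hγ₀ hμ k)
    -- The decay of the drift is discarded: the rate comes entirely from the factor `‖θ - θ'‖`.
    have hsq : ∀ u : ℝ≥0∞, ENNReal.ofReal ρ ^ k * u ^ 2 + β ^ 2 ≤ (u + β) ^ 2 := fun u => by
      calc ENNReal.ofReal ρ ^ k * u ^ 2 + β ^ 2 ≤ 1 * u ^ 2 + β ^ 2 := by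
            gcongr
            exact pow_le_one' hr.le k
        _ ≤ u ^ 2 + β ^ 2 + 2 * u * β := by rw [one_mul]; exact le_self_add
        _ = _ := by ring
    have hone : ENNReal.ofReal ρ + (1 - ENNReal.ofReal ρ) = 1 := add_tsub_cancel_of_le hr.le
    have hcost := SGD.wasserstein_bind_pow_le hfst hsnd (SGD.measurable_cost θstar τ₂ γ μ)
      (a := ENNReal.ofReal (4 * q)) (by simpa using hq₀) ENNReal.ofReal_ne_top k
      (fun x => ?_) ν π
    · rwa [SGD.invariant_pow hπ] at hcost
    · have := SGD.isMarkovKernel_pow K k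
      simp only [SGD.ofReal_cost θstar hnoise.nonneg_τ]
      refine (SGD.lintegral_enorm_sub_mul_le ((K ^ k) x) θstar x (q := ENNReal.ofReal q)
        ?_ ?_ ?_).trans ?_
      · have h := SGD.lintegral_pow_le K m₀ (B := 0) hone (by simpa using k₀) k x
        rw [mul_pow]
        exact h.trans (by rw [add_zero]; gcongr)
      · exact (SGD.lintegral_pow_le K m₁ hone k₁ k x).trans (hsq _)
      · exact (SGD.lintegral_pow_le K m₂ hone k₂ k x).trans (hsq _)
      -- The argument gives the constant `2`, weakened here to `4`.
      · gcongr
        rw [ENNReal.ofReal_mul zero_le_four, ENNReal.ofReal_ofNat]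
        gcongr
        norm_num
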